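/- **Setting.** Let $\widetilde X$ be a smooth projective irreducible curve over $\mathbb C$ and let $x_1\neq x_2$ be closed points of $\widetilde X$ (the preimages of the node of a nodal curve with normalization $\widetilde X$). Let $d\in\mathbb Z$, let $r,a_i,b_i,c_i$ be natural numbers and let $L_1,L_2$ be line bundles on $\widetilde X$. A generalized parabolic bundle $(E,q)$ of rank $r$ and degree $d$ is a vector bundle $E$ of that rank and degree with a surjective linear map $q:E_{x_1}\oplus E_{x_2}\to R$ of complex vector spaces, where $E_{x_1},E_{x_2}$ are the fibres. For a subbundle $F\subseteq E$ put $\deg_{\mathrm{par}}F=\deg F-\dim q(F_{x_1}\oplus F_{x_2})$. Write $E_{a,b}=(E^{\otimes a})^{\oplus b}$. A 2-dgpb $(E,q,\varphi_1,\varphi_2)$ consists of a generalized parabolic bundle $(E,q)$ and nonzero morphisms $\varphi_i:E_{a_i,b_i}\to L_i\otimes(\det E)^{\otimes c_i}$, $i=1,2$. A dgpb $(E,q,\varphi)$ has a single nonzero morphism $\varphi:E_{a,b}\to L$ to a line bundle. A weighted filtration $(E^\bullet,\underline\alpha)$ of $E$ is a chain of subbundles $0\subsetneq E_1\subsetneq\dots\subsetneq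 E_s\subsetneq E_{s+1}=E$ with $s\ge 1$, together with positive rational weights $\alpha_1,\dots,\alpha_s$. Put $$P(E^\bullet,\underline\alpha)=\sum_{j=1}^s\alpha_j\big(\operatorname{rk}E_j\,\deg_{\mathrm{par}}E-\operatorname{rk}E\,\deg_{\mathrm{par}}E_j\big),$$ and for $1\le j\le s+1$ $$\gamma_j=\sum_{k\ge j}\alpha_k(\operatorname{rk}E_k-r)+\sum_{k<j}\alpha_k\operatorname{rk}E_k,$$ where $k$ runs over $1,\dots,s$. A nonzero $\varphi:E_{a,b}\to L$ with $L$ a line bundle induces a section $\sigma:\widetilde X\to\mathbb P(E_{a,b})$, where $\sigma(x)$ is the class of a nonzero functional on the fibre of $E_{a,b}$ at $x$. Put $$\mu_{a,b}(E^\bullet,\underline\alpha;\varphi)=\max_{x}\Big(-\min\{\gamma_{j_1}+\dots+\gamma_{j_a}\;:\;\sigma(x)\text{ is not identically }0\text{ on the fibre at }x\text{ of }(E_{j_1}\otimes\dots\otimes E_{j_a})^{\oplus b}\}\Big).$$ For $\delta_1,\delta_2,\delta\in\mathbb Q_{>0}$, the 2-dgpb $(E,q,\varphi_1,\varphi_2)$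 is $(\delta_1,\delta_2)$-semistable (resp. stable) if $P(E^\bullet,\underline\alpha)+\delta_1\mu_{a_1,b_1}(E^\bullet,\underline\alpha;\varphi_1)+\delta_2\mu_{a_2,b_2}(E^\bullet,\underline\alpha;\varphi_2)\ge0$ (resp. $>0$) for every weighted filtration of $E$. A dgpb $(E,q,\varphi)$ is $\delta$-semistable (resp. stable) if $P(E^\bullet,\underline\alpha)+\delta\,\mu_{a,b}(E^\bullet,\underline\alpha;\varphi)\ge0$ (resp. $>0$) for every weighted filtration of $E$. Let $(E,q,\varphi_1,\varphi_2)$ be a 2-dgpb, $a=a_1+a_2$, $b=b_1b_2$, and let $$\varphi=\varphi_1\otimes\varphi_2:\;E_{a,b}\cong E_{a_1,b_1}\otimes E_{a_2,b_2}\to \big(L_1\otimes(\det E)^{\otimes c_1}\big)\otimes\big(L_2\otimes(\det E)^{\otimes c_2}\big),$$ that is, the morphism induced by $\widetilde X\to\mathbb P(E_{a_1,b_1})\times\mathbb P(E_{a_2,b_2})$ followed by the Segre embedding. **Theorem and Corollary.** The morphism $\varphi$ is nonzero, and for every weighted filtration of $E$ $$\mu_{a,b}(E^\bullet,\underline\alpha;\varphi)=\mu_{a_1,b_1}(E^\bullet,\underline\alpha;\varphi_1)+\mu_{a_2,b_2}(E^\bullet,\underline\alpha;\varphi_2).$$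 Consequently, for every $\delta\in\mathbb Q_{>0}$, $(E,q,\varphi_1,\varphi_2)$ is $(\delta,\delta)$-semistable if and only if $(E,q,\varphi)$ is $\delta$-semistable, and $(E,q,\varphi_1,\varphi_2)$ is $(\delta,\delta)$-stable if and only if $(E,q,\varphi)$ is $\delta$-stable. -/

import Mathlib

open CategoryTheory AlgebraicGeometry MonoidalCategory Limits

noncomputable section

namespace DecBundle

section Modules

variable {X : Scheme.{0}}

/-! ### Presheaves of modules, sheafification, stalks -/

/-- Presheaves of `𝒪_X`-modules. -/
abbrev PreMod (X : Scheme.{0}) : Type 1 :=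
  PresheafOfModules.{0} (X.presheaf ⋙ forget₂ CommRingCat.{0} RingCat.{0})

/-- The inclusion of sheaves of `𝒪_X`-modules into presheaves. -/
def toPreMod (X : Scheme.{0}) : X.Modules ⥤ PreMod X :=
  Scheme.Modules.toPresheafOfModules X

/-- Sheafification, with its universe-fixed Mathlib source and target. -/
def assocSheafAux (X : Scheme.{0}) :
    X.PresheafOfModules ⥤ SheafOfModules.{0} X.ringCatSheaf :=
  PresheafOfModules.sheafification (𝟙 X.ringCatSheaf.obj)

/-- The sheaf of modules associated to a presheaf of modules. -/
def assocSheaf (X : Scheme.{0}) : PreMod X ⥤ X.Modules := assocSheafAux X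

/-- Sheafification is left adjoint to the inclusion. -/
def assocSheafAdj (X : Scheme.{0}) : assocSheaf X ⊣ toPreMod X :=
  (PresheafOfModules.sheafificationAdjunction (𝟙 X.ringCatSheaf.obj) : )

/-- The stalk `E_x`. -/
abbrev Stalk (E : X.Modules) (x : X) : Type := ↑(TopCat.Presheaf.stalk E.presheaf x)

instance preStalk (P : PreMod X) (x : X) : Module (X.presheaf.stalk x)
    ↑(TopCat.Presheaf.stalk P.presheaf x) := inferInstance

instance (E : X.Modules) (x : X) : Module (X.presheaf.stalk x) (Stalk E x) :=
  preStalk ((toPreMod X).obj E) x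

theorem germ_smul (E : X.Modules) (x : X) (U : X.Opens) (hx : x ∈ U) (c : Γ(X, U)) (s : Γ(E, U)) :
    E.presheaf.germ U x hx (c • s) = (X.presheaf.germ U x hx c • E.presheaf.germ U x hx s : Stalk E x) :=
  PresheafOfModules.germ_smul (R := X.presheaf) E.val x U hx c s

/-- The map induced on stalks at `x`, as an `𝒪_{X,x}`-linear map. -/
def stalkMap {E F : X.Modules} (g : E ⟶ F) (x : X) :
    Stalk E x →ₗ[X.presheaf.stalk x] Stalk F x where
  toFun t := (TopCat.Presheaf.stalkFunctor Ab x).map g.mapPresheaf t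
  map_add' s t := map_add _ s t
  map_smul' c t := by
    obtain ⟨U, hU, s, rfl⟩ := TopCat.Presheaf.exists_germ_eq E.presheaf t
    obtain ⟨V, hV, c, rfl⟩ := TopCat.Presheaf.exists_germ_eq X.presheaf c
    obtain ⟨W, hW, c', s', h1, h2⟩ : ∃ (W : X.Opens) (hW : x ∈ W) (c' : Γ(X, W)) (s' : Γ(E, W)),
        X.presheaf.germ W x hW c' = X.presheaf.germ V x hV c ∧
        E.presheaf.germ W x hW s' = E.presheaf.germ U x hU s :=
      ⟨U ⊓ V, ⟨hU, hV⟩, X.presheaf.map (homOfLE inf_le_right).op c,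
        E.presheaf.map (homOfLE inf_le_left).op s,
        TopCat.Presheaf.germ_res_apply _ _ _ _ _, TopCat.Presheaf.germ_res_apply _ _ _ _ _⟩
    have h3 : ∀ z : Γ(E, W), (TopCat.Presheaf.stalkFunctor Ab x).map g.mapPresheaf
        (E.presheaf.germ W x hW z) = F.presheaf.germ W x hW (g.app W z) :=
      fun z => TopCat.Presheaf.stalkFunctor_map_germ_apply W x hW g.mapPresheaf z
    rw [← h1, ← h2]
    refine (congrArg _ (germ_smul E x W hW c' s').symm).trans ((h3 _).trans ?_)
    rw [Scheme.Modules.Hom.app_smul, germ_smul, h3]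
    rfl

/-- The specialization map from the stalk at `x` to the stalk at the generic point. -/
def toGeneric [IsIntegral X] (E : X.Modules) (x : X) : Stalk E x → Stalk E (genericPoint X) :=
  E.presheaf.stalkSpecializes ((genericPoint_spec X).specializes trivial)

/-! ### Vector bundles, rank, degree, subbundles -/

/-- `E` is locally free of rank `r`: every point has an open neighbourhood `U` and sections
`e₁, …, e_r` of `E` over `U` which form a basis of `E(V)` over `𝒪(V)` for every open `V ⊆ U`. -/
def IsVectorBundle (E : X.Modules) (r : ℕ) : Prop :=
  ∀ x : X, ∃ (U : X.Opens) (_ : x ∈ U) (e : Fin r → Γ(E, U)), ∀ (V : X.Opens) (h : V ≤ U),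
    Function.Bijective
      (fun c : Fin r → Γ(X, V) => ∑ i, c i • E.presheaf.map (homOfLE h).op (e i))

/-- The (generic) rank of a sheaf of modules on an integral scheme. -/
def rk [IsIntegral X] (E : X.Modules) : ℕ :=
  Module.finrank (X.presheaf.stalk (genericPoint X)) (Stalk E (genericPoint X))

open Classical in
/-- The degree of a vector bundle `E` of rank `n` on a curve, as the degree of the divisor of a
rational section of `det E`. For a basis `v` of the generic stalk and a basis `f` of the stalk at
`x`, write `fᵢ = ∑ⱼ Mⱼᵢ vⱼ`; then `v₁ ∧ … ∧ vₙ = det(M)⁻¹ f₁ ∧ … ∧ fₙ` has order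
`- ord_x (det M)` at `x`. (The function `Scheme.ord` vanishes at the generic point.) -/
def degree [IsIntegral X] [IsLocallyNoetherian X] (E : X.Modules) : ℤ :=
  if h : ∀ x : X, Nonempty (Module.Basis (Fin (rk E)) (X.presheaf.stalk x) (Stalk E x)) then
    - ∑ᶠ x : X, Scheme.ord (X := X) (Matrix.det ((h (genericPoint X)).some.toMatrix
        fun i => toGeneric E x ((h x).some i))) x
  else 0

/-- A subsheaf of `E` is a subbundle if it and the quotient by it are locally free. -/
def IsSubbundle {E : X.Modules} (F : Subobject E) : Prop :=
  (∃ m, IsVectorBundle (F : X.Modules) m) ∧ ∃ n, IsVectorBundle (cokernel F.arrow) n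

/-! ### Tensor products -/

/-- The presheaf tensor product `F₁ ⊗ ⋯ ⊗ F_a`. -/
def preTensor : (a : ℕ) → (Fin a → PreMod X) → PreMod X
  | 0, _ => 𝟙_ (PreMod X)
  | a + 1, F => preTensor a (fun i => F i.castSucc) ⊗ F (Fin.last a)

/-- The tensor product `f₁ ⊗ ⋯ ⊗ f_a` of morphisms. -/
def preTensorMap : (a : ℕ) → {F G : Fin a → PreMod X} → (∀ i, F i ⟶ G i) →
    (preTensor a F ⟶ preTensor a G)
  | 0, _, _, _ => 𝟙 _
  | a + 1, _, _, f => preTensorMap a (fun i => f i.castSucc) ⊗ₘ f (Fin.last a)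

/-- The tensor power `P^{⊗ a}`. -/
abbrev preTensorPow (P : PreMod X) (a : ℕ) : PreMod X := preTensor a fun _ => P

/-- The canonical isomorphism `P^{⊗ (a + a')} ≅ P^{⊗ a} ⊗ P^{⊗ a'}`. -/
def preTensorPowAdd (P : PreMod X) (a : ℕ) :
    (a' : ℕ) → (preTensorPow P (a + a') ≅ preTensorPow P a ⊗ preTensorPow P a')
  | 0 => (ρ_ (preTensorPow P a)).symm
  | a' + 1 => whiskerRightIso (preTensorPowAdd P a a') P ≪≫
      α_ (preTensorPow P a) (preTensorPow P a') P

/-- The tensor product of two sheaves of modules. -/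
abbrev tensorSheaf (M N : X.Modules) : X.Modules :=
  (assocSheaf X).obj ((toPreMod X).obj M ⊗ (toPreMod X).obj N)

instance : HasFiniteBiproducts X.Modules := Abelian.hasFiniteBiproducts

/-- The sheaf `(F₁ ⊗ ⋯ ⊗ F_a)^{⊕ b}`. -/
def tensorSum {a : ℕ} (F : Fin a → X.Modules) (b : ℕ) : X.Modules :=
  ⨁ fun _ : Fin b => (assocSheaf X).obj (preTensor a fun i => (toPreMod X).obj (F i))

/-- The morphism `(f₁ ⊗ ⋯ ⊗ f_a)^{⊕ b}`. -/
def tensorSumMap {a : ℕ} {F G : Fin a → X.Modules} (f : ∀ i, F i ⟶ G i) (b : ℕ) :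
    tensorSum F b ⟶ tensorSum G b :=
  biproduct.map fun _ => (assocSheaf X).map (preTensorMap a fun i => (toPreMod X).map (f i))

/-- `E_{a,b} = (E^{⊗ a})^{⊕ b}`. -/
abbrev tensorType (E : X.Modules) (a b : ℕ) : X.Modules := tensorSum (fun _ : Fin a => E) b

/-- `⋀ⁿ` of the sections of `P` over `U`. -/
abbrev extObj (P : PreMod X) (n : ℕ) (U : X.Opensᵒᵖ) : ModuleCat.{0} (X.presheaf.obj U) :=
  ModuleCat.exteriorPower (R := X.presheaf.obj U) (P.obj U) n

/-- The alternating map `(m₁, …, mₙ) ↦ m₁|_V ∧ … ∧ mₙ|_V`. -/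
def extAlt (P : PreMod X) (n : ℕ) {U V : X.Opensᵒᵖ} (f : U ⟶ V) :
    ModuleCat.AlternatingMap (R := X.presheaf.obj U) (P.obj U)
      ((ModuleCat.restrictScalars (X.presheaf.map f).hom).obj (extObj P n V)) n where
  toFun m := ModuleCat.exteriorPower.mk (R := X.presheaf.obj V) (M := P.obj V)
    (fun i => P.map f (m i))
  map_update_add' m i x y := by
    have h : ∀ z : P.obj U, (fun j => P.map f (Function.update m i z j)) =
        Function.update (fun j => P.map f (m j)) i (P.map f z) := by
      intro z; funext j
      by_cases hj : j = i
      · subst hj; simp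
      · simp [hj]
    erw [h, h, h, map_add]
    exact AlternatingMap.map_update_add (exteriorPower.ιMulti (X.presheaf.obj V) n
      (M := P.obj V)) _ _ _ _
  map_update_smul' m i c x := by
    have h : ∀ z : P.obj U, (fun j => P.map f (Function.update m i z j)) =
        Function.update (fun j => P.map f (m j)) i (P.map f z) := by
      intro z; funext j
      by_cases hj : j = i
      · subst hj; simp
      · simp [hj]
    erw [h, h, P.map_smul]
    exact AlternatingMap.map_update_smul (exteriorPower.ιMulti (X.presheaf.obj V) n
      (M := P.obj V)) _ _ _ _
  map_eq_zero_of_eq' m i j hij hne :=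
    AlternatingMap.map_eq_zero_of_eq (exteriorPower.ιMulti (X.presheaf.obj V) n
      (M := P.obj V)) _ (congrArg (fun z => P.map f z) hij) hne

/-- The exterior power presheaf `U ↦ ⋀ⁿ P(U)`. -/
def extPow (P : PreMod X) (n : ℕ) : PreMod X where
  obj U := extObj P n U
  map f := ModuleCat.exteriorPower.desc (extAlt P n f)
  map_id U := by
    apply ModuleCat.exteriorPower.hom_ext (R := X.presheaf.obj U)
    ext m
    refine (ModuleCat.exteriorPower.desc_mk (R := X.presheaf.obj U) (extAlt P n (𝟙 U)) m).trans ?_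
    exact congrArg (ModuleCat.exteriorPower.mk (R := X.presheaf.obj U) (M := P.obj U))
      (funext fun i => by simp; rfl)
  map_comp f g := by
    apply ModuleCat.exteriorPower.hom_ext (R := X.presheaf.obj _)
    ext m
    refine (ModuleCat.exteriorPower.desc_mk (R := X.presheaf.obj _) (extAlt P n (f ≫ g)) m).trans ?_
    have h1 := ModuleCat.exteriorPower.desc_mk (R := X.presheaf.obj _) (extAlt P n f) m
    have h2 := ModuleCat.exteriorPower.desc_mk (R := X.presheaf.obj _) (extAlt P n g)
      (fun i => P.map f (m i))
    refine Eq.trans ?_ (h2.symm.trans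
      (congrArg (fun z => (ModuleCat.exteriorPower.desc (extAlt P n g)) z) h1.symm))
    exact congrArg (ModuleCat.exteriorPower.mk (R := X.presheaf.obj _) (M := P.obj _))
      (funext fun i => P.map_comp_apply f g (m i))

/-- The determinant `⋀ʳ E` of a vector bundle of rank `r`. -/
def detBundle (E : X.Modules) (r : ℕ) : X.Modules :=
  (assocSheaf X).obj (extPow ((toPreMod X).obj E) r)

/-- The twist `L ⊗ D^{⊗ c}`. -/
abbrev twist (L D : X.Modules) (c : ℕ) : X.Modules :=
  (assocSheaf X).obj ((toPreMod X).obj L ⊗ preTensorPow ((toPreMod X).obj D) c)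

/-! ### The Segre product of two decorations -/

/-- The `i`-th component `E^{⊗ a} ⟶ M` of a morphism `E_{a,b} ⟶ M`, on presheaves. -/
def component {E M : X.Modules} {a b : ℕ} (φ : tensorType E a b ⟶ M) (i : Fin b) :
    preTensorPow ((toPreMod X).obj E) a ⟶ (toPreMod X).obj M :=
  (assocSheafAdj X).homEquiv _ _
    (biproduct.ι (fun _ : Fin b =>
      (assocSheaf X).obj (preTensorPow ((toPreMod X).obj E) a)) i ≫ φ)

/-- The morphism `φ₁ ⊗ φ₂ : E_{a₁,b₁} ⊗ E_{a₂,b₂} ⟶ M₁ ⊗ M₂`, where the source is identified with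
`E_{a₁+a₂,b₁b₂}`: its component of index `(i, j)` is `φ₁ᵢ ⊗ φ₂ⱼ`. It induces the composition of
the pair of sections `X ⟶ ℙ(E_{a₁,b₁}) × ℙ(E_{a₂,b₂})` with the Segre embedding. -/
def segre {E M₁ M₂ : X.Modules} {a₁ b₁ a₂ b₂ : ℕ}
    (φ₁ : tensorType E a₁ b₁ ⟶ M₁) (φ₂ : tensorType E a₂ b₂ ⟶ M₂) :
    tensorType E (a₁ + a₂) (b₁ * b₂) ⟶ tensorSheaf M₁ M₂ :=
  biproduct.desc fun k : Fin (b₁ * b₂) => (assocSheaf X).map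
    ((preTensorPowAdd ((toPreMod X).obj E) a₁ a₂).hom ≫
      (component φ₁ (finProdFinEquiv.symm k).1 ⊗ₘ component φ₂ (finProdFinEquiv.symm k).2))

/-! ### Weighted filtrations and the function `μ` -/

/-- A weighted filtration `0 ⊊ E₁ ⊊ ⋯ ⊊ E_s ⊊ E` by subbundles, `s ≥ 1`, with positive rational
weights. -/
structure WeightedFiltration (E : X.Modules) where
  length : ℕ
  length_pos : 0 < length
  sub : Fin length → Subobject E
  strictMono : StrictMono sub
  ne_bot : ∀ j, sub j ≠ ⊥
  ne_top : ∀ j, sub j ≠ ⊤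
  isSubbundle : ∀ j, IsSubbundle (sub j)
  weight : Fin length → ℚ
  weight_pos : ∀ j, 0 < weight j

/-- The steps `E₁, …, E_s, E_{s+1} = E` of the filtration. -/
def WeightedFiltration.step {E : X.Modules} (W : WeightedFiltration E) :
    Fin (W.length + 1) → Subobject E :=
  Fin.snoc (α := fun _ => Subobject E) W.sub ⊤

/-- The common value, on the indices in `(rk E_{j-1}, rk E_j]`, of the vector
`∑ₖ αₖ (rk Eₖ - r, …, rk Eₖ - r, rk Eₖ, …, rk Eₖ)` (with `rk Eₖ` entries `rk Eₖ - r`). -/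
def WeightedFiltration.gamma [IsIntegral X] {E : X.Modules} (W : WeightedFiltration E)
    (j : Fin (W.length + 1)) : ℚ :=
  ∑ k : Fin W.length, W.weight k *
    (if j ≤ k.castSucc then (rk (W.sub k : X.Modules) : ℚ) - rk E
      else (rk (W.sub k : X.Modules) : ℚ))

/-- For a nonzero `φ : E_{a,b} ⟶ L`, the point `σ(x)` of `ℙ(E_{a,b})` over `x` is the class of
the functional on the fibre obtained from `φ_x` on regarding it as a surjection onto its image
(which is a free module of rank one) and reducing modulo the maximal ideal. This says that the
functional does not vanish on the image of `(F₁ ⊗ ⋯ ⊗ F_a)^{⊕ b}`. -/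
def NonvanishingOn {E L : X.Modules} {a b : ℕ} (φ : tensorType E a b ⟶ L)
    (F : Fin a → Subobject E) (x : X) : Prop :=
  ∃ t : Stalk (tensorSum (fun i => (F i : X.Modules)) b) x,
    stalkMap (tensorSumMap (fun i => (F i).arrow) b ≫ φ) x t ∉
      IsLocalRing.maximalIdeal (X.presheaf.stalk x) • LinearMap.range (stalkMap φ x)

/-- `μ(λ; σ(x)) = - min {γ_{j₁} + ⋯ + γ_{j_a} | σ(x) is nonzero on (E_{j₁} ⊗ ⋯ ⊗ E_{j_a})^{⊕ b}}`
(a minimum over a finite set, nonempty when `φ ≠ 0`). -/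
def muAt [IsIntegral X] {E L : X.Modules} {a b : ℕ} (φ : tensorType E a b ⟶ L)
    (W : WeightedFiltration E) (x : X) : ℝ :=
  - sInf {t : ℝ | ∃ J : Fin a → Fin (W.length + 1),
      NonvanishingOn φ (fun i => W.step (J i)) x ∧ t = ((∑ i, W.gamma (J i) : ℚ) : ℝ)}

/-- `μ(E^•, α; φ) = max_x μ(λ; σ(x))` (only finitely many values occur). -/
def mu [IsIntegral X] {E L : X.Modules} {a b : ℕ} (φ : tensorType E a b ⟶ L)
    (W : WeightedFiltration E) : ℝ :=
  ⨆ x : X, muAt φ W x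

end Modules

/-! ### Decorated generalized parabolic bundles on a curve -/

/-- A smooth projective (irreducible) curve over `ℂ`. -/
structure Curve where
  X : Scheme.{0}
  π : X ⟶ Spec (CommRingCat.of ℂ)
  [integral : IsIntegral X]
  [smooth : SmoothOfRelativeDimension 1 π]
  [proper : IsProper π]

attribute [instance] Curve.integral Curve.smooth Curve.proper

instance (C : Curve) : IsLocallyNoetherian C.X :=
  LocallyOfFiniteType.isLocallyNoetherian C.π

/-- The structure map `ℂ → 𝒪_{X,x}`. -/
def Curve.toStalk (C : Curve) (x : C.X) : ℂ →+* C.X.presheaf.stalk x :=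
  (C.X.presheaf.germ ⊤ x trivial).hom.comp
    (C.π.appTop.hom.comp (Scheme.ΓSpecIso (CommRingCat.of ℂ)).inv.hom)

/-- The fibre `E(x) = E_x / 𝔪_x E_x`. -/
abbrev Fiber (C : Curve) (E : C.X.Modules) (x : C.X) : Type :=
  Stalk E x ⧸ (IsLocalRing.maximalIdeal (C.X.presheaf.stalk x) •
    (⊤ : Submodule (C.X.presheaf.stalk x) (Stalk E x)))

/-- The fibre as a complex vector space. -/
instance (C : Curve) (E : C.X.Modules) (x : C.X) : Module ℂ (Fiber C E x) :=
  Module.compHom _ (C.toStalk x)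

/-- The map on fibres induced by a morphism. -/
def fiberMap (C : Curve) {E F : C.X.Modules} (g : E ⟶ F) (x : C.X) :
    Fiber C E x →ₗ[ℂ] Fiber C F x where
  toFun := Submodule.mapQ _ _ (stalkMap g x) (by
    rw [← Submodule.map_le_iff_le_comap, Submodule.map_smul'']
    exact Submodule.smul_mono le_rfl le_top)
  map_add' := map_add _
  map_smul' c v := LinearMap.map_smul _ (C.toStalk x c) v

/-- A generalized parabolic bundle `(E, q)` of rank `r` and degree `d` with support `x₁ + x₂`:
a vector bundle `E` and a surjection `q : E(x₁) ⊕ E(x₂) → R` of complex vector spaces. -/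
structure GPB (C : Curve) (x₁ x₂ : C.X) (d : ℤ) (r : ℕ) where
  E : C.X.Modules
  isVectorBundle : IsVectorBundle E r
  degree_eq : degree E = d
  R : Type
  [addCommGroup : AddCommGroup R]
  [module : Module ℂ R]
  q : (Fiber C E x₁ × Fiber C E x₂) →ₗ[ℂ] R
  q_surjective : Function.Surjective q

attribute [instance] GPB.addCommGroup GPB.module

namespace GPB

variable {C : Curve} {x₁ x₂ : C.X} {d : ℤ} {r : ℕ} (A : GPB C x₁ x₂ d r)

/-- The parabolic degree `deg F - dim q(F(x₁) ⊕ F(x₂))` of a subsheaf `F` of `E`. -/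
def parDegree (F : Subobject A.E) : ℤ :=
  degree (F : C.X.Modules) - Module.finrank ℂ
    (LinearMap.range (A.q ∘ₗ (fiberMap C F.arrow x₁).prodMap (fiberMap C F.arrow x₂)))

/-- `P(E^•, α) = ∑ⱼ αⱼ (rk Eⱼ deg_par E - rk E deg_par Eⱼ)`. -/
def P (W : WeightedFiltration A.E) : ℚ :=
  ∑ j : Fin W.length, W.weight j *
    ((rk (W.sub j : C.X.Modules) : ℚ) * A.parDegree ⊤ - (rk A.E : ℚ) * A.parDegree (W.sub j))

end GPB

/-- A decorated generalized parabolic bundle `(E, q, φ)`, `φ : E_{a,b} ⟶ L`. -/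
structure DGPB (C : Curve) (x₁ x₂ : C.X) (d : ℤ) (r a b : ℕ) (L : C.X.Modules) extends
    GPB C x₁ x₂ d r where
  φ : tensorType E a b ⟶ L

/-- A double-decorated generalized parabolic bundle `(E, q, φ₁, φ₂)`, the decorations
`(E^{⊗ aᵢ})^{⊕ bᵢ} ⊗ (det E)^{⊗ -cᵢ} ⟶ Lᵢ` being written as morphisms
`φᵢ : E_{aᵢ,bᵢ} ⟶ Lᵢ ⊗ (det E)^{⊗ cᵢ}`. -/
structure TwoDGPB (C : Curve) (x₁ x₂ : C.X) (d : ℤ) (r a₁ b₁ c₁ a₂ b₂ c₂ : ℕ)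
    (L₁ L₂ : C.X.Modules) extends GPB C x₁ x₂ d r where
  φ₁ : tensorType E a₁ b₁ ⟶ twist L₁ (detBundle E r) c₁
  φ₂ : tensorType E a₂ b₂ ⟶ twist L₂ (detBundle E r) c₂

section Stability

variable {C : Curve} {x₁ x₂ : C.X} {d : ℤ} {r : ℕ}

/-- `δ`-semistability of `(E, q, φ)`. -/
def DGPB.IsSemistable {a b : ℕ} {L : C.X.Modules} (B : DGPB C x₁ x₂ d r a b L) (δ : ℚ) : Prop :=
  ∀ W : WeightedFiltration B.E, 0 ≤ (B.P W : ℝ) + δ * mu B.φ W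

/-- `δ`-stability of `(E, q, φ)`. -/
def DGPB.IsStable {a b : ℕ} {L : C.X.Modules} (B : DGPB C x₁ x₂ d r a b L) (δ : ℚ) : Prop :=
  ∀ W : WeightedFiltration B.E, 0 < (B.P W : ℝ) + δ * mu B.φ W

variable {a₁ b₁ c₁ a₂ b₂ c₂ : ℕ} {L₁ L₂ : C.X.Modules}

/-- `(δ₁, δ₂)`-semistability of `(E, q, φ₁, φ₂)`. -/
def TwoDGPB.IsSemistable (T : TwoDGPB C x₁ x₂ d r a₁ b₁ c₁ a₂ b₂ c₂ L₁ L₂) (δ₁ δ₂ : ℚ) : Prop :=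
  ∀ W : WeightedFiltration T.E, 0 ≤ (T.P W : ℝ) + δ₁ * mu T.φ₁ W + δ₂ * mu T.φ₂ W

/-- `(δ₁, δ₂)`-stability of `(E, q, φ₁, φ₂)`. -/
def TwoDGPB.IsStable (T : TwoDGPB C x₁ x₂ d r a₁ b₁ c₁ a₂ b₂ c₂ L₁ L₂) (δ₁ δ₂ : ℚ) : Prop :=
  ∀ W : WeightedFiltration T.E, 0 < (T.P W : ℝ) + δ₁ * mu T.φ₁ W + δ₂ * mu T.φ₂ W

/-- The decorated generalized parabolic bundle associated to a double-decorated one through the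
Segre embedding, with the target `(L₁ ⊗ (det E)^{⊗ c₁}) ⊗ (L₂ ⊗ (det E)^{⊗ c₂})`. -/
def TwoDGPB.toDGPB (T : TwoDGPB C x₁ x₂ d r a₁ b₁ c₁ a₂ b₂ c₂ L₁ L₂) :
    DGPB C x₁ x₂ d r (a₁ + a₂) (b₁ * b₂)
      (tensorSheaf (twist L₁ (detBundle T.E r) c₁) (twist L₂ (detBundle T.E r) c₂)) where
  toGPB := T.toGPB
  φ := segre T.φ₁ T.φ₂

end Stability

end DecBundle

end

open DecBundle

/-! The curve is integral, so `μ` can be computed at the generic point, where the statement is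
linear algebra over the function field.

Write `σ(x)` for the functional induced by a decoration `φ : E_{a,b} ⟶ L`. If `σ(x)` is nonzero on a
tensor product of filtration steps at some `x`, then `φ` composed with the map from these steps is a
nonzero morphism. As `L` is torsion-free, this composite is already nonzero at the generic point,
where the maximal ideal is zero (`nonvanishingOn_genericPoint_iff`). Hence the set of admissible
weight sums at `x` lies in the one at the generic point, whose infimum is therefore the smallest. So
the maximum over `x` is attained there (`mu_eq_muAt_genericPoint`). The comparison of infima needs
every such set to be nonempty, which Nakayama's lemma provides (`nonvanishingOn_of_isIso`).

The components of the Segre product are the tensor products of the components of `φ₁` and `φ₂`, and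
a tensor product of two morphisms to locally free sheaves on an integral scheme vanishes only if a
factor does (`tensorHom_comp_toAssoc_ne_zero`). So a multi-index of length `a₁ + a₂` is admissible
for the Segre product exactly when its two halves are admissible for `φ₁` and `φ₂`. The set of
weight sums is then the Minkowski sum of the two sets (`weightSums_segre`), and the infimum of a
Minkowski sum is the sum of the infima. Equality of the stability conditions follows because `P`
depends only on the underlying generalized parabolic bundle. -/

noncomputable section

namespace DecBundle

variable {X : Scheme.{0}}

/-! ### Sections and local freeness -/

/-- Sections of a presheaf of modules. -/
def Sec (P : PreMod X) (U : X.Opens) : Type := P.obj (.op U)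

instance (P : PreMod X) (U : X.Opens) : AddCommGroup (Sec P U) :=
  inferInstanceAs (AddCommGroup (P.obj (.op U)))

instance (P : PreMod X) (U : X.Opens) : Module Γ(X, U) (Sec P U) := (P.obj (.op U)).isModule

/-- Restriction of functions. -/
abbrev resO {U V : X.Opens} (h : V ≤ U) : Γ(X, U) →+* Γ(X, V) := (X.presheaf.map (homOfLE h).op).hom

/-- Restriction of sections. -/
def res (P : PreMod X) {U V : X.Opens} (h : V ≤ U) : Sec P U →+ Sec P V where
  toFun s := P.map (homOfLE h).op s
  map_zero' := map_zero _
  map_add' := map_add _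

theorem res_smul (P : PreMod X) {U V : X.Opens} (h : V ≤ U) (c : Γ(X, U)) (s : Sec P U) :
    res P h (c • s) = resO h c • res P h s :=
  P.map_smul (homOfLE h).op c s

theorem res_res (P : PreMod X) {U V W : X.Opens} (h : V ≤ U) (h' : W ≤ V) (s : Sec P U) :
    res P h' (res P h s) = res P (h'.trans h) s :=
  (P.map_comp_apply (homOfLE h).op (homOfLE h').op s).symm

/-- The map induced on sections by a morphism. -/
def appSec {P Q : PreMod X} (f : P ⟶ Q) (U : X.Opens) : Sec P U →ₗ[Γ(X, U)] Sec Q U :=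
  (f.app (.op U)).hom

theorem appSec_res {P Q : PreMod X} (f : P ⟶ Q) {U V : X.Opens} (h : V ≤ U) (s : Sec P U) :
    appSec f V (res P h s) = res Q h (appSec f U s) :=
  PresheafOfModules.naturality_apply f (homOfLE h).op s

theorem appSec_comp {P Q R : PreMod X} (f : P ⟶ Q) (g : Q ⟶ R) (U : X.Opens) (s : Sec P U) :
    appSec (f ≫ g) U s = appSec g U (appSec f U s) := rfl

theorem hom_ext_sec {P Q : PreMod X} {f g : P ⟶ Q}
    (h : ∀ U s, appSec f U s = appSec g U s) : f = g := by
  ext U s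
  exact h U.unop s

theorem exists_appSec_ne_zero {P Q : PreMod X} {f : P ⟶ Q} (h : f ≠ 0) :
    ∃ U s, appSec f U s ≠ 0 := by
  by_contra! h'
  exact h (hom_ext_sec fun U s => h' U s)

/-- The section `s ⊗ t` of a tensor product. -/
def tmulSec {P Q : PreMod X} {U : X.Opens} (s : Sec P U) (t : Sec Q U) : Sec (P ⊗ Q) U :=
  TensorProduct.tmul (Γ(X, U)) s t

theorem res_tmulSec {P Q : PreMod X} {U V : X.Opens} (h : V ≤ U) (s : Sec P U) (t : Sec Q U) :
    res (P ⊗ Q) h (tmulSec s t) = tmulSec (res P h s) (res Q h t) := rfl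

theorem appSec_tmulSec {P P' Q Q' : PreMod X} (f : P ⟶ P') (g : Q ⟶ Q') {U : X.Opens} (s : Sec P U)
    (t : Sec Q U) : appSec (f ⊗ₘ g) U (tmulSec s t) = tmulSec (appSec f U s) (appSec g U t) := rfl

/-- The linear equivalence between sections of the tensor product and the tensor product of
sections. -/
def tensorSec (P Q : PreMod X) (U : X.Opens) :
    TensorProduct Γ(X, U) (Sec P U) (Sec Q U) ≃ₗ[Γ(X, U)] Sec (P ⊗ Q) U :=
  LinearEquiv.refl _ _

theorem tensorSec_tmul {P Q : PreMod X} {U : X.Opens} (s : Sec P U) (t : Sec Q U) :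
    tensorSec P Q U (TensorProduct.tmul _ s t) = tmulSec s t := rfl

/-- The linear equivalence between sections of the exterior power and the exterior power of
sections. -/
def extSec (P : PreMod X) (n : ℕ) (U : X.Opens) :
    (⋀[Γ(X, U)]^n (Sec P U)) ≃ₗ[Γ(X, U)] Sec (extPow P n) U :=
  LinearEquiv.refl _ _

theorem res_extSec (P : PreMod X) (n : ℕ) {U V : X.Opens} (h : V ≤ U) (m : Fin n → Sec P U) :
    res (extPow P n) h (extSec P n U (exteriorPower.ιMulti _ n m)) =
      extSec P n V (exteriorPower.ιMulti _ n fun i => res P h (m i)) :=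
  ModuleCat.exteriorPower.desc_mk (R := X.presheaf.obj (.op U)) (extAlt P n (homOfLE h).op) m

/-- A family of sections over `U` is a frame if it restricts to a basis over every open subset. -/
def IsFrame (P : PreMod X) {ι : Type} (U : X.Opens) (e : ι → Sec P U) : Prop :=
  ∀ (V : X.Opens) (h : V ≤ U), ∃ B : Module.Basis ι Γ(X, V) (Sec P V), ∀ i, B i = res P h (e i)

theorem IsFrame.restrict {P : PreMod X} {ι : Type} {U : X.Opens} {e : ι → Sec P U}
    (he : IsFrame P U e) {V : X.Opens} (h : V ≤ U) : IsFrame P V fun i => res P h (e i) := by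
  intro W hW
  obtain ⟨B, hB⟩ := he W (hW.trans h)
  exact ⟨B, fun i => by rw [hB, res_res]⟩

/-- A presheaf of modules is locally free if it has finite frames locally. -/
def LocFree (P : PreMod X) : Prop :=
  ∀ x : X, ∃ (U : X.Opens) (_ : x ∈ U) (ι : Type) (_ : Fintype ι) (e : ι → Sec P U), IsFrame P U e

theorem IsVectorBundle.locFree {E : X.Modules} {r : ℕ} (hE : IsVectorBundle E r) :
    LocFree ((toPreMod X).obj E) := by
  intro x
  obtain ⟨U, hU, e, he⟩ := hE x
  refine ⟨U, hU, Fin r, inferInstance, e, fun V h => ?_⟩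
  let f : (Fin r → Γ(X, V)) →ₗ[Γ(X, V)] Sec ((toPreMod X).obj E) V :=
    Fintype.linearCombination Γ(X, V) fun i => res ((toPreMod X).obj E) h (e i)
  have hf : Function.Bijective f := he V h
  refine ⟨.ofEquivFun (LinearEquiv.ofBijective f hf).symm, fun i => ?_⟩
  rw [Module.Basis.coe_ofEquivFun]
  change f (Pi.single i 1) = _
  simp [f]

theorem locFree_unit : LocFree (𝟙_ (PreMod X)) := by
  intro x
  refine ⟨⊤, trivial, Unit, inferInstance, fun _ => (1 : Γ(X, ⊤)), fun V h => ?_⟩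
  refine ⟨(Module.Basis.singleton Unit Γ(X, V)).map
    (LinearEquiv.refl _ _ : Γ(X, V) ≃ₗ[Γ(X, V)] Sec (𝟙_ (PreMod X)) V), fun i => ?_⟩
  exact (Module.Basis.singleton_apply Unit Γ(X, V) i).trans (map_one (resO h)).symm

theorem isFrame_tensor {P Q : PreMod X} {ι κ : Type} {U : X.Opens} {e : ι → Sec P U}
    {f : κ → Sec Q U} (he : IsFrame P U e) (hf : IsFrame Q U f) :
    IsFrame (P ⊗ Q) U fun i : ι × κ => tmulSec (e i.1) (f i.2) := by
  intro V h
  obtain ⟨B, hB⟩ := he V h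
  obtain ⟨B', hB'⟩ := hf V h
  refine ⟨(B.tensorProduct B').map (tensorSec P Q V), fun i => ?_⟩
  rw [Module.Basis.map_apply, Module.Basis.tensorProduct_apply', tensorSec_tmul, res_tmulSec, hB,
    hB']

theorem LocFree.tensor {P Q : PreMod X} (hP : LocFree P) (hQ : LocFree Q) : LocFree (P ⊗ Q) := by
  intro x
  obtain ⟨U, hU, ι, _, e, he⟩ := hP x
  obtain ⟨U', hU', ι', _, e', he'⟩ := hQ x
  exact ⟨U ⊓ U', ⟨hU, hU'⟩, ι × ι', inferInstance, _,
    isFrame_tensor (he.restrict inf_le_left) (he'.restrict inf_le_right)⟩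

theorem LocFree.preTensor : ∀ (a : ℕ) {F : Fin a → PreMod X}, (∀ i, LocFree (F i)) →
    LocFree (preTensor a F)
  | 0, _, _ => locFree_unit
  | a + 1, _, h => (LocFree.preTensor a fun i => h i.castSucc).tensor (h (Fin.last a))

theorem LocFree.extPow {P : PreMod X} (hP : LocFree P) (n : ℕ) : LocFree (extPow P n) := by
  intro x
  obtain ⟨U, hU, ι, _, e, he⟩ := hP x
  classical
  -- An arbitrary order on the index type, needed to write the wedges of `n`-element subsets in
  -- increasing order.
  let _ : LinearOrder ι := linearOrderOfSTO WellOrderingRel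
  refine ⟨U, hU, Set.powersetCard ι n, Fintype.ofFinite _,
    fun s => extSec P n U (exteriorPower.ιMulti_family _ n e s), fun V h => ?_⟩
  obtain ⟨B, hB⟩ := he V h
  refine ⟨(B.exteriorPower n).map (extSec P n V), fun s => ?_⟩
  rw [Module.Basis.map_apply, exteriorPower.basis_apply]
  refine Eq.trans ?_ (res_extSec P n h _).symm
  rw [exteriorPower.ιMulti_family]
  congr 2
  funext i
  exact hB _

/-! ### Sheafification and frames -/

/-- The canonical morphism from a presheaf to its sheafification. -/
abbrev toAssoc (P : PreMod X) : P ⟶ (toPreMod X).obj ((assocSheaf X).obj P) :=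
  (assocSheafAdj X).unit.app P

theorem sec_eq_zero_of_locally (M : X.Modules) {V : X.Opens} (s : Sec ((toPreMod X).obj M) V)
    (h : ∀ x ∈ V, ∃ (W : X.Opens) (hW : W ≤ V), x ∈ W ∧ res ((toPreMod X).obj M) hW s = 0) :
    s = 0 := by
  refine M.isSheaf.section_ext (s := s) (t := (0 : Sec ((toPreMod X).obj M) V)) fun x hx => ?_
  obtain ⟨W, hW, hxW, h0⟩ := h x hx
  exact ⟨W, hW, hxW, h0.trans (map_zero (res ((toPreMod X).obj M) hW)).symm⟩

theorem toAssoc_locally_injective (P : PreMod X) {V : X.Opens} (s : Sec P V)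
    (hs : appSec (toAssoc P) V s = 0) (x : X) (hx : x ∈ V) :
    ∃ (W : X.Opens) (hW : W ≤ V), x ∈ W ∧ res P hW s = 0 := by
  have h := Presheaf.equalizerSieve_mem (Opens.grothendieckTopology X)
    (CategoryTheory.toSheafify (Opens.grothendieckTopology X) P.presheaf)
    (X := .op V) s (0 : Sec P V) (hs.trans (map_zero (appSec (toAssoc P) V)).symm)
  obtain ⟨W, f, hf, hxW⟩ := h x hx
  exact ⟨W, f.le, hxW, Eq.trans hf (map_zero (res P f.le))⟩

theorem toAssoc_locally_surjective (P : PreMod X) {V : X.Opens}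
    (t : Sec ((toPreMod X).obj ((assocSheaf X).obj P)) V) (x : X) (hx : x ∈ V) :
    ∃ (W : X.Opens) (hW : W ≤ V) (_ : x ∈ W) (s : Sec P W), appSec (toAssoc P) W s =
      res ((toPreMod X).obj ((assocSheaf X).obj P)) hW t := by
  have h := Presheaf.imageSieve_mem (Opens.grothendieckTopology X)
    (CategoryTheory.toSheafify (Opens.grothendieckTopology X) P.presheaf) (U := .op V) t
  obtain ⟨W, f, ⟨s, hs⟩, hxW⟩ := h x hx
  exact ⟨W, f.le, hxW, s, hs⟩

theorem fun_eq_zero_of_locally {V : X.Opens} (c : Γ(X, V))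
    (h : ∀ x ∈ V, ∃ (W : X.Opens) (hW : W ≤ V), x ∈ W ∧ resO hW c = 0) : c = 0 := by
  refine X.IsSheaf.section_ext fun x hx => ?_
  obtain ⟨W, hW, hxW, h0⟩ := h x hx
  exact ⟨W, hW, hxW, h0.trans (map_zero (resO hW)).symm⟩

theorem IsFrame.linearIndependent {P : PreMod X} {ι : Type} {U : X.Opens} {e : ι → Sec P U}
    (he : IsFrame P U e) {V : X.Opens} (h : V ≤ U) :
    LinearIndependent Γ(X, V) fun i => res P h (e i) := by
  obtain ⟨B, hB⟩ := he V h
  rw [← funext hB]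
  exact B.linearIndependent

theorem IsFrame.exists_sum {P : PreMod X} {ι : Type} [Fintype ι] {U : X.Opens} {e : ι → Sec P U}
    (he : IsFrame P U e) {V : X.Opens} (h : V ≤ U) (s : Sec P V) :
    ∃ c : ι → Γ(X, V), s = ∑ i, c i • res P h (e i) := by
  obtain ⟨B, hB⟩ := he V h
  refine ⟨B.equivFun s, ?_⟩
  simp only [← hB]
  exact (B.sum_equivFun s).symm

theorem res_sum_smul (P : PreMod X) {ι : Type} [Fintype ι] {U V W : X.Opens} (h : V ≤ U)
    (h' : W ≤ V) (c : ι → Γ(X, V)) (e : ι → Sec P U) :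
    res P h' (∑ i, c i • res P h (e i)) = ∑ i, resO h' (c i) • res P (h'.trans h) (e i) := by
  simp [map_sum, res_smul, res_res]

/-- A presheaf with a frame over `U` behaves like a free module there, and `𝒪_X` is a sheaf, so
sheafifying adds nothing over `U`. A relation between the images holds locally in `P`, which kills
its coefficients locally and hence globally. A section of the sheafification has coefficients
locally; by independence they agree on overlaps and glue. -/
theorem IsFrame.assocSheaf {P : PreMod X} {ι : Type} [Fintype ι] {U : X.Opens} {e : ι → Sec P U}
    (he : IsFrame P U e) : IsFrame ((toPreMod X).obj ((assocSheaf X).obj P)) U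
      fun i => appSec (toAssoc P) U (e i) := by
  set Q := (toPreMod X).obj ((DecBundle.assocSheaf X).obj P) with hQ
  have key : ∀ {V : X.Opens} (h : V ≤ U) (c : ι → Γ(X, V)),
      ∑ i, c i • res Q h (appSec (toAssoc P) U (e i)) =
        appSec (toAssoc P) V (∑ i, c i • res P h (e i)) := by
    intro V h c
    simp [map_sum, appSec_res]
    rfl
  have indep : ∀ {V : X.Opens} (h : V ≤ U) (c : ι → Γ(X, V)),
      ∑ i, c i • res Q h (appSec (toAssoc P) U (e i)) = 0 → ∀ i, c i = 0 := by
    intro V h c hc i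
    rw [key] at hc
    refine fun_eq_zero_of_locally _ fun x hx => ?_
    obtain ⟨W, hW, hxW, h0⟩ := toAssoc_locally_injective P _ hc x hx
    rw [res_sum_smul] at h0
    exact ⟨W, hW, hxW, Fintype.linearIndependent_iff.1 (he.linearIndependent (hW.trans h)) _ h0 i⟩
  intro V h
  have hspan : ∀ t : Sec Q V, ∃ c : ι → Γ(X, V),
      ∑ i, c i • res Q h (appSec (toAssoc P) U (e i)) = t := by
    intro t
    have loc : ∀ x : V, ∃ (W : X.Opens) (hW : W ≤ V) (_ : x.1 ∈ W) (c : ι → Γ(X, W)),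
        ∑ i, c i • res Q (hW.trans h) (appSec (toAssoc P) U (e i)) = res Q hW t := by
      intro x
      obtain ⟨W, hW, hxW, s, hs⟩ := toAssoc_locally_surjective P t x.1 x.2
      obtain ⟨c, rfl⟩ := he.exists_sum (hW.trans h) s
      exact ⟨W, hW, hxW, c, (key _ _).trans hs⟩
    choose W hW hxW c hc using loc
    have cover : V ≤ iSup W := fun x hx => TopologicalSpace.Opens.mem_iSup.2 ⟨⟨x, hx⟩, hxW _⟩
    have glue : ∀ i, ∃ d : Γ(X, V), ∀ x, resO (hW x) d = c x i := by
      intro i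
      refine (X.sheaf.existsUnique_gluing' W V (fun x => homOfLE (hW x)) cover
        (fun x => c x i) fun x y => ?_).exists
      change resO inf_le_left (c x i) = resO inf_le_right (c y i)
      -- Both coefficient vectors express the restriction of `t` to the overlap, so their difference
      -- is a relation.
      have := indep ((inf_le_left : W x ⊓ W y ≤ W x).trans ((hW x).trans h))
        (fun i => resO inf_le_left (c x i) - resO inf_le_right (c y i)) (by
          simp only [sub_smul, Finset.sum_sub_distrib]
          rw [← res_sum_smul Q ((hW x).trans h) inf_le_left,
            ← res_sum_smul Q ((hW y).trans h) inf_le_right, hc, hc, res_res, res_res, sub_self])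
      exact sub_eq_zero.1 (this i)
    choose d hd using glue
    refine ⟨d, sub_eq_zero.1 (sec_eq_zero_of_locally _ _ fun x hx => ?_)⟩
    refine ⟨W ⟨x, hx⟩, hW _, hxW _, ?_⟩
    refine (map_sub (res Q (hW ⟨x, hx⟩)) _ _).trans ?_
    rw [res_sum_smul, ← hc]
    simp only [hd, sub_self]
  refine ⟨.mk (v := fun i => res Q h (appSec (toAssoc P) U (e i)))
    (Fintype.linearIndependent_iff.2 fun c hc => indep h c hc) fun t _ => ?_, fun i => ?_⟩
  · obtain ⟨c, rfl⟩ := hspan t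
    exact Submodule.sum_mem _ fun i _ => Submodule.smul_mem _ _ (Submodule.subset_span ⟨i, rfl⟩)
  · rw [Module.Basis.mk_apply]

theorem LocFree.assocSheaf {P : PreMod X} (hP : LocFree P) :
    LocFree ((toPreMod X).obj ((assocSheaf X).obj P)) := by
  intro x
  obtain ⟨U, hU, ι, _, e, he⟩ := hP x
  exact ⟨U, hU, ι, inferInstance, _, he.assocSheaf⟩

theorem toAssoc_injective_of_isFrame {P : PreMod X} {ι : Type} [Fintype ι] {U : X.Opens}
    {e : ι → Sec P U} (he : IsFrame P U e) : Function.Injective (appSec (toAssoc P) U) := by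
  rw [← LinearMap.ker_eq_bot, LinearMap.ker_eq_bot']
  intro s hs
  obtain ⟨c, rfl⟩ := he.exists_sum le_rfl s
  suffices h : ∀ i, c i = 0 by simp [h]
  intro i
  refine fun_eq_zero_of_locally _ fun x hx => ?_
  obtain ⟨W, hW, hxW, h0⟩ := toAssoc_locally_injective P _ hs x hx
  rw [res_sum_smul] at h0
  exact ⟨W, hW, hxW, Fintype.linearIndependent_iff.1 (he.linearIndependent hW) _ h0 i⟩

theorem locFree_tensorSheaf {M N : X.Modules} (hM : LocFree ((toPreMod X).obj M))
    (hN : LocFree ((toPreMod X).obj N)) : LocFree ((toPreMod X).obj (tensorSheaf M N)) :=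
  (hM.tensor hN).assocSheaf

theorem locFree_twist_detBundle {E L : X.Modules} (hE : LocFree ((toPreMod X).obj E))
    (hL : LocFree ((toPreMod X).obj L)) (r c : ℕ) :
    LocFree ((toPreMod X).obj (twist L (detBundle E r) c)) :=
  (hL.tensor (LocFree.preTensor c fun _ => (hE.extPow r).assocSheaf)).assocSheaf

/-- A sheaf has only the zero section over the empty set, where the local vanishing condition is
vacuous. -/
theorem nonempty_of_sec_ne_zero {M : X.Modules} {V : X.Opens} {s : Sec ((toPreMod X).obj M) V}
    (hs : s ≠ 0) : (V : Set X).Nonempty := by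
  by_contra h
  refine hs (sec_eq_zero_of_locally _ _ fun x hx => ?_)
  exact absurd ⟨x, hx⟩ h

/-! ### Torsion-freeness on integral schemes -/

section Integral

variable [IsIntegral X]

theorem resO_injective {U V : X.Opens} (h : V ≤ U) (hV : (V : Set X).Nonempty) :
    Function.Injective (resO h) := by
  have : Nonempty V := hV.to_subtype
  exact map_injective_of_isIntegral X (homOfLE h)

theorem IsFrame.res_injective {P : PreMod X} {ι : Type} [Fintype ι] {U : X.Opens} {e : ι → Sec P U}
    (he : IsFrame P U e) {V W : X.Opens} (h : V ≤ U) (h' : W ≤ V) (hW : (W : Set X).Nonempty) :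
    Function.Injective (res P h') := by
  rw [injective_iff_map_eq_zero]
  intro s hs
  obtain ⟨c, rfl⟩ := he.exists_sum h s
  rw [res_sum_smul] at hs
  have h0 := Fintype.linearIndependent_iff.1 (he.linearIndependent (h'.trans h)) _ hs
  refine Finset.sum_eq_zero fun i _ => ?_
  rw [(map_eq_zero_iff _ (resO_injective h' hW)).1 (h0 i), zero_smul]

theorem inter_nonempty {U V : X.Opens} (hU : (U : Set X).Nonempty) (hV : (V : Set X).Nonempty) :
    ((U ⊓ V : X.Opens) : Set X).Nonempty :=
  nonempty_preirreducible_inter U.isOpen V.isOpen hU hV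

/-- Vanishing is local, so it suffices to work near each point on an open set carrying a frame. By
irreducibility this open set meets `W`, and restriction is injective on coefficients because the
scheme is integral. -/
theorem LocFree.res_injective {M : X.Modules} (hM : LocFree ((toPreMod X).obj M)) {V W : X.Opens}
    (h : W ≤ V) (hW : (W : Set X).Nonempty) : Function.Injective (res ((toPreMod X).obj M) h) := by
  rw [injective_iff_map_eq_zero]
  intro s hs
  refine sec_eq_zero_of_locally _ _ fun x hx => ?_
  obtain ⟨U, hU, ι, _, e, he⟩ := hM x
  refine ⟨U ⊓ V, inf_le_right, ⟨hU, hx⟩, ?_⟩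
  refine he.res_injective inf_le_left (inf_le_left : (U ⊓ V) ⊓ W ≤ U ⊓ V)
    (inter_nonempty ⟨x, hU, hx⟩ hW) ?_
  rw [res_res, map_zero, ← res_res _ h inf_le_right, hs, map_zero]

/-- A tensor product of nonzero morphisms to locally free sheaves is nonzero. -/
theorem tensorHom_comp_toAssoc_ne_zero {P Q : PreMod X} {M N : X.Modules}
    (hM : LocFree ((toPreMod X).obj M)) (hN : LocFree ((toPreMod X).obj N))
    {u : P ⟶ (toPreMod X).obj M} {v : Q ⟶ (toPreMod X).obj N} (hu : u ≠ 0) (hv : v ≠ 0) :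
    (u ⊗ₘ v) ≫ toAssoc _ ≠ 0 := by
  obtain ⟨U, s, hs⟩ := exists_appSec_ne_zero hu
  obtain ⟨V, t, ht⟩ := exists_appSec_ne_zero hv
  obtain ⟨A, hA, ι, _, e, he⟩ := hM (genericPoint X)
  obtain ⟨B, hB, κ, _, f, hf⟩ := hN (genericPoint X)
  -- A nonempty open set on which both sections live, remain nonzero, and have targets with frames.
  let W := (U ⊓ V) ⊓ (A ⊓ B)
  have hW : (W : Set X).Nonempty :=
    inter_nonempty (inter_nonempty (nonempty_of_sec_ne_zero hs) (nonempty_of_sec_ne_zero ht))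
      (inter_nonempty ⟨_, hA⟩ ⟨_, hB⟩)
  have hWU : W ≤ U := inf_le_left.trans inf_le_left
  have hWV : W ≤ V := inf_le_left.trans inf_le_right
  have hWA : W ≤ A := inf_le_right.trans inf_le_left
  have hWB : W ≤ B := inf_le_right.trans inf_le_right
  rw [← map_ne_zero_iff _ (hM.res_injective hWU hW), ← appSec_res] at hs
  rw [← map_ne_zero_iff _ (hN.res_injective hWV hW), ← appSec_res] at ht
  intro h0
  have h1 : appSec (toAssoc _) W (tmulSec (appSec u W (res P hWU s)) (appSec v W (res Q hWV t))) =
      0 := by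
    rw [← appSec_tmulSec, ← appSec_comp, h0]
    rfl
  have he' := he.restrict hWA
  have hf' := hf.restrict hWB
  -- Nonemptiness makes `Γ(X, W)` a domain, so the product of two nonzero coordinates, which is a
  -- coordinate of the tensor, is nonzero.
  have : Nonempty W := hW.to_subtype
  obtain ⟨C, -⟩ := he' W le_rfl
  obtain ⟨D, -⟩ := hf' W le_rfl
  -- The frame of the presheaf tensor product lets the vanishing in the sheafification be read
  -- before sheafifying.
  have h2 := toAssoc_injective_of_isFrame (isFrame_tensor he' hf') (h1.trans (map_zero _).symm)
  obtain ⟨i, hi⟩ : ∃ i, C.repr (appSec u W (res P hWU s)) i ≠ 0 := by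
    by_contra! h
    exact hs (C.repr.map_eq_zero_iff.1 (Finsupp.ext h))
  obtain ⟨j, hj⟩ : ∃ j, D.repr (appSec v W (res Q hWV t)) j ≠ 0 := by
    by_contra! h
    exact ht (D.repr.map_eq_zero_iff.1 (Finsupp.ext h))
  have h3 : (C.tensorProduct D).repr (TensorProduct.tmul _ (appSec u W (res P hWU s))
      (appSec v W (res Q hWV t))) (i, j) = 0 := by
    refine (congrArg (fun z => (C.tensorProduct D).repr z (i, j)) h2).trans ?_
    exact DFunLike.congr_fun (map_zero (C.tensorProduct D).repr) (i, j)
  rw [Module.Basis.tensorProduct_repr_tmul_apply, smul_eq_mul] at h3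
  exact (mul_ne_zero hj hi) h3

end Integral

/-! ### Maps on stalks -/

/-- The germ at `x` of a section. -/
def germSec (M : X.Modules) (x : X) {U : X.Opens} (hx : x ∈ U) (s : Sec ((toPreMod X).obj M) U) :
    Stalk M x :=
  M.presheaf.germ U x hx s

theorem exists_germSec_eq (M : X.Modules) (x : X) (t : Stalk M x) :
    ∃ (U : X.Opens) (hx : x ∈ U) (s : Sec ((toPreMod X).obj M) U), germSec M x hx s = t :=
  TopCat.Presheaf.exists_germ_eq M.presheaf t

theorem germSec_res (M : X.Modules) (x : X) {U V : X.Opens} (h : V ≤ U) (hx : x ∈ V)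
    (s : Sec ((toPreMod X).obj M) U) :
    germSec M x hx (res _ h s) = germSec M x (h hx) s :=
  TopCat.Presheaf.germ_res_apply M.presheaf (homOfLE h) x hx s

theorem germSec_zero (M : X.Modules) (x : X) {U : X.Opens} (hx : x ∈ U) :
    germSec M x hx 0 = 0 :=
  map_zero (M.presheaf.germ U x hx).hom

theorem germSec_sum_smul (M : X.Modules) (x : X) {U : X.Opens} (hx : x ∈ U) {ι : Type} [Fintype ι]
    (c : ι → Γ(X, U)) (s : ι → Sec ((toPreMod X).obj M) U) :
    germSec M x hx (∑ i, c i • s i) = ∑ i, X.presheaf.germ U x hx (c i) • germSec M x hx (s i) := by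
  refine (map_sum (M.presheaf.germ U x hx).hom _ _).trans (Finset.sum_congr rfl fun i _ => ?_)
  exact germ_smul M x U hx (c i) (s i)

theorem exists_res_eq_zero_of_germSec (M : X.Modules) (x : X) {U : X.Opens} (hx : x ∈ U)
    (s : Sec ((toPreMod X).obj M) U) (h : germSec M x hx s = 0) :
    ∃ (V : X.Opens) (hV : V ≤ U), x ∈ V ∧ res _ hV s = 0 := by
  obtain ⟨V, hxV, i, j, hij⟩ := TopCat.Presheaf.germ_eq M.presheaf x hx hx s
    (0 : Sec ((toPreMod X).obj M) U) (h.trans (germSec_zero M x hx).symm)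
  exact ⟨V, i.le, hxV, Eq.trans hij (map_zero (res ((toPreMod X).obj M) j.le))⟩

theorem stalkMap_germSec {M N : X.Modules} (g : M ⟶ N) (x : X) {U : X.Opens} (hx : x ∈ U)
    (s : Sec ((toPreMod X).obj M) U) :
    stalkMap g x (germSec M x hx s) = germSec N x hx (appSec ((toPreMod X).map g) U s) :=
  TopCat.Presheaf.stalkFunctor_map_germ_apply U x hx g.mapPresheaf s

theorem stalkMap_zero {M N : X.Modules} (x : X) (t : Stalk M x) :
    stalkMap (0 : M ⟶ N) x t = 0 := by
  obtain ⟨U, hx, s, rfl⟩ := exists_germSec_eq M x t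
  rw [stalkMap_germSec]
  exact germSec_zero N x hx

theorem stalkMap_comp {M N K : X.Modules} (f : M ⟶ N) (g : N ⟶ K) (x : X) (t : Stalk M x) :
    stalkMap (f ≫ g) x t = stalkMap g x (stalkMap f x t) := by
  obtain ⟨U, hx, s, rfl⟩ := exists_germSec_eq M x t
  rw [stalkMap_germSec, stalkMap_germSec, stalkMap_germSec]
  rfl

theorem stalkMap_id {M : X.Modules} (x : X) (t : Stalk M x) : stalkMap (𝟙 M) x t = t := by
  obtain ⟨U, hx, s, rfl⟩ := exists_germSec_eq M x t
  rw [stalkMap_germSec]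
  rfl

theorem stalkMap_surjective_of_isIso {M N : X.Modules} (f : M ⟶ N) [IsIso f] (x : X) :
    Function.Surjective (stalkMap f x) := fun t =>
  ⟨stalkMap (inv f) x t, by rw [← stalkMap_comp, IsIso.inv_hom_id, stalkMap_id]⟩

theorem LocFree.finite_stalk {M : X.Modules} (hM : LocFree ((toPreMod X).obj M)) (x : X) :
    Module.Finite (X.presheaf.stalk x) (Stalk M x) := by
  obtain ⟨U, hU, ι, _, e, he⟩ := hM x
  refine .of_surjective
    (Fintype.linearCombination (X.presheaf.stalk x) fun i => germSec M x hU (e i)) fun t => ?_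
  obtain ⟨V, hV, s, rfl⟩ := exists_germSec_eq M x t
  obtain ⟨c, hc⟩ := he.exists_sum (inf_le_left : U ⊓ V ≤ U) (res _ inf_le_right s)
  refine ⟨fun i => X.presheaf.germ (U ⊓ V) x ⟨hU, hV⟩ (c i), ?_⟩
  rw [← germSec_res M x (inf_le_right : U ⊓ V ≤ V) (show x ∈ U ⊓ V from ⟨hU, hV⟩) s, hc]
  refine Eq.trans ?_ (germSec_sum_smul M x _ c _).symm
  rw [Fintype.linearCombination_apply]
  simp only [germSec_res]

section Integral

variable [IsIntegral X]

theorem LocFree.germSec_eq_zero {M : X.Modules} (hM : LocFree ((toPreMod X).obj M)) (x : X)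
    {U : X.Opens} (hx : x ∈ U) {s : Sec ((toPreMod X).obj M) U} (h : germSec M x hx s = 0) :
    s = 0 := by
  obtain ⟨V, hV, hxV, h0⟩ := exists_res_eq_zero_of_germSec M x hx s h
  exact (map_eq_zero_iff _ (hM.res_injective hV ⟨x, hxV⟩)).1 h0

theorem genericPoint_mem {U : X.Opens} (hU : (U : Set X).Nonempty) : genericPoint X ∈ U :=
  ((genericPoint_spec X).mem_open_set_iff U.isOpen).2 (by simpa using hU)

theorem exists_stalkMap_genericPoint_ne_zero {M N : X.Modules}
    (hN : LocFree ((toPreMod X).obj N)) {g : M ⟶ N} (hg : g ≠ 0) :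
    ∃ t, stalkMap g (genericPoint X) t ≠ 0 := by
  have hg' : (toPreMod X).map g ≠ 0 := fun h =>
    hg (Scheme.Modules.hom_ext _ _ fun U => by
      ext s
      exact congrArg (fun f => appSec f U s) h)
  obtain ⟨U, s, hs⟩ := exists_appSec_ne_zero hg'
  refine ⟨germSec M _ (genericPoint_mem (nonempty_of_sec_ne_zero hs)) s, fun h => hs ?_⟩
  rw [stalkMap_germSec] at h
  exact hN.germSec_eq_zero _ _ h

/-- The generic stalk is the function field, so the reduction modulo the maximal ideal in
`NonvanishingOn` has no effect there. -/
theorem maximalIdeal_genericPoint :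
    IsLocalRing.maximalIdeal (X.presheaf.stalk (genericPoint X)) = ⊥ :=
  IsLocalRing.isField_iff_maximalIdeal_eq.1 (isField_stalk_of_closure_mem_irreducibleComponents X _
    (by simp [irreducibleComponents_eq_singleton]))

end Integral

/-! ### Components of decorations -/

/-- The `k`-th inclusion `F₁ ⊗ ⋯ ⊗ F_a ⟶ (F₁ ⊗ ⋯ ⊗ F_a)^{⊕ b}`. -/
def inclusion {a : ℕ} (F : Fin a → X.Modules) (b : ℕ) (k : Fin b) :
    (assocSheaf X).obj (preTensor a fun i => (toPreMod X).obj (F i)) ⟶ tensorSum F b :=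
  biproduct.ι (fun _ : Fin b => (assocSheaf X).obj (preTensor a fun i => (toPreMod X).obj (F i))) k

theorem inclusion_tensorSumMap_comp {a : ℕ} {F G : Fin a → X.Modules} (f : ∀ i, F i ⟶ G i) (b : ℕ)
    (k : Fin b) {M : X.Modules} (φ : tensorSum G b ⟶ M) :
    inclusion F b k ≫ tensorSumMap f b ≫ φ =
      (assocSheaf X).map (preTensorMap a fun i => (toPreMod X).map (f i)) ≫
        inclusion G b k ≫ φ :=
  biproduct.ι_map_assoc (f := fun _ : Fin b =>
    (assocSheaf X).obj (preTensor a fun i => (toPreMod X).obj (F i)))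
    (fun _ : Fin b => (assocSheaf X).map (preTensorMap a fun i => (toPreMod X).map (f i))) k φ

theorem tensorSum_hom_ext {a : ℕ} {F : Fin a → X.Modules} {b : ℕ} {M : X.Modules}
    {φ ψ : tensorSum F b ⟶ M} (h : ∀ k, inclusion F b k ≫ φ = inclusion F b k ≫ ψ) : φ = ψ :=
  biproduct.hom_ext' _ _ h

theorem component_eq_homEquiv {E M : X.Modules} {a b : ℕ} (φ : tensorType E a b ⟶ M) (k : Fin b) :
    component φ k = (assocSheafAdj X).homEquiv _ _ (inclusion (fun _ => E) b k ≫ φ) := rfl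

theorem component_eq {E M : X.Modules} {a b : ℕ} (φ : tensorType E a b ⟶ M) (k : Fin b) :
    component φ k = toAssoc _ ≫ (toPreMod X).map (inclusion (fun _ => E) b k ≫ φ) :=
  (assocSheafAdj X).homEquiv_unit _ _ _

theorem homEquiv_eq_zero_iff {P : PreMod X} {M : X.Modules} (g : (assocSheaf X).obj P ⟶ M) :
    (assocSheafAdj X).homEquiv _ _ g = 0 ↔ g = 0 := by
  have h : (assocSheafAdj X).homEquiv P M 0 = 0 := by
    rw [Adjunction.homEquiv_unit]
    exact hom_ext_sec fun U s => rfl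
  rw [← h, EmbeddingLike.apply_eq_iff_eq]

/-- The universal properties of the biproduct and of sheafification move the vanishing to presheaf
components, where it can be tested on tensors of sections. -/
theorem tensorSumMap_comp_eq_zero_iff {E M : X.Modules} {a b : ℕ} {F : Fin a → X.Modules}
    (f : ∀ i, F i ⟶ E) (φ : tensorType E a b ⟶ M) :
    tensorSumMap f b ≫ φ = 0 ↔
      ∀ k, preTensorMap a (fun i => (toPreMod X).map (f i)) ≫ component φ k = 0 := by
  have h : ∀ k, preTensorMap a (fun i => (toPreMod X).map (f i)) ≫ component φ k =
      (assocSheafAdj X).homEquiv _ _ (inclusion F b k ≫ tensorSumMap f b ≫ φ) := by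
    intro k
    rw [component_eq_homEquiv, inclusion_tensorSumMap_comp, Adjunction.homEquiv_naturality_left]
  simp only [h, homEquiv_eq_zero_iff]
  exact ⟨fun h k => by rw [h, comp_zero],
    fun h => tensorSum_hom_ext fun k => (h k).trans comp_zero.symm⟩

instance isIso_preTensorMap : ∀ (a : ℕ) {F G : Fin a → PreMod X} (f : ∀ i, F i ⟶ G i)
    [∀ i, IsIso (f i)], IsIso (preTensorMap a f)
  | 0, _, _, _, _ => inferInstanceAs (IsIso (𝟙 _))
  | a + 1, _, _, f, _ => by
    have := isIso_preTensorMap a fun i => f i.castSucc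
    exact inferInstanceAs (IsIso (preTensorMap a (fun i => f i.castSucc) ⊗ₘ f (Fin.last a)))

instance isIso_tensorSumMap {a : ℕ} {F G : Fin a → X.Modules} (f : ∀ i, F i ⟶ G i)
    [∀ i, IsIso (f i)] (b : ℕ) : IsIso (tensorSumMap f b) :=
  (biproduct.mapIso fun _ : Fin b => asIso ((assocSheaf X).map
    (preTensorMap a fun i => (toPreMod X).map (f i)))).isIso_hom

theorem tensorSumMap_comp_ne_zero {E M : X.Modules} {a b : ℕ} {F : Fin a → X.Modules}
    (f : ∀ i, F i ⟶ E) [∀ i, IsIso (f i)] {φ : tensorType E a b ⟶ M} (hφ : φ ≠ 0) :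
    tensorSumMap f b ≫ φ ≠ 0 := fun h =>
  hφ ((cancel_epi (tensorSumMap f b)).1 (h.trans comp_zero.symm))

section Integral

variable [IsIntegral X]

/-- A nonzero morphism from `E_{a,b}` to a locally free sheaf is nonzero on every stalk. -/
theorem exists_stalkMap_ne_zero {E M : X.Modules} {a b : ℕ} (hE : LocFree ((toPreMod X).obj E))
    (hM : LocFree ((toPreMod X).obj M)) {φ : tensorType E a b ⟶ M} (hφ : φ ≠ 0) (x : X) :
    ∃ t, stalkMap φ x t ≠ 0 := by
  by_contra! h
  -- Taking identities for the maps reduces the vanishing of `φ` to that of its components.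
  refine tensorSumMap_comp_ne_zero (fun _ => 𝟙 E) hφ ((tensorSumMap_comp_eq_zero_iff _ _).2 ?_)
  intro k
  suffices h0 : component φ k = 0 by
    rw [h0]
    exact hom_ext_sec fun U s => rfl
  have near : ∀ (U : X.Opens) (_ : x ∈ U) (s : Sec (preTensorPow ((toPreMod X).obj E) a) U),
      appSec (component φ k) U s = 0 := by
    intro U hx s
    refine hM.germSec_eq_zero x hx ?_
    rw [component_eq, appSec_comp, ← stalkMap_germSec, stalkMap_comp, h]
  -- The frame elements of `E^{⊗ a}` live on a neighbourhood `A` of `x`, so `near` kills them. They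
  -- span the sections over `A ⊓ U`, which is dense enough to detect sections of `M` over `U`,
  -- although `U` itself need not contain `x`.
  obtain ⟨A, hA, ι, _, e, he⟩ := LocFree.preTensor a (fun _ => hE) x
  refine hom_ext_sec fun U s => ?_
  change appSec (component φ k) U s = 0
  by_contra hs
  refine hs ((map_eq_zero_iff _ (hM.res_injective (inf_le_right : A ⊓ U ≤ U)
    (inter_nonempty ⟨x, hA⟩ (nonempty_of_sec_ne_zero hs)))).1 ?_)
  obtain ⟨c, hc⟩ := he.exists_sum (inf_le_left : A ⊓ U ≤ A) (res _ inf_le_right s)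
  rw [← appSec_res, hc, map_sum]
  refine Finset.sum_eq_zero fun i _ => ?_
  rw [map_smul, appSec_res, near A hA, map_zero, smul_zero]

/-! ### Nonvanishing -/

omit [IsIntegral X] in
theorem NonvanishingOn.comp_ne_zero {E L : X.Modules} {a b : ℕ} {φ : tensorType E a b ⟶ L}
    {F : Fin a → Subobject E} {x : X} (h : NonvanishingOn φ F x) :
    tensorSumMap (fun i => (F i).arrow) b ≫ φ ≠ 0 := by
  obtain ⟨t, ht⟩ := h
  intro h0
  rw [h0, stalkMap_zero] at ht
  exact ht (Submodule.zero_mem _)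

theorem nonvanishingOn_genericPoint_iff {E L : X.Modules} {a b : ℕ}
    (hL : LocFree ((toPreMod X).obj L)) (φ : tensorType E a b ⟶ L) (F : Fin a → Subobject E) :
    NonvanishingOn φ F (genericPoint X) ↔ tensorSumMap (fun i => (F i).arrow) b ≫ φ ≠ 0 := by
  refine ⟨NonvanishingOn.comp_ne_zero, fun h => ?_⟩
  obtain ⟨t, ht⟩ := exists_stalkMap_genericPoint_ne_zero hL h
  refine ⟨t, ?_⟩
  rw [maximalIdeal_genericPoint, Submodule.bot_smul, Submodule.mem_bot]
  exact ht

/-- If the functional vanished at `x`, the image `I` of `φ_x` would satisfy `I ≤ 𝔪 I`. It is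
finitely generated, being contained in a finite module over a Noetherian local ring, so Nakayama
gives `I = 0`, contradicting that `φ` is nonzero on every stalk. -/
theorem nonvanishingOn_of_isIso [IsLocallyNoetherian X] {E L : X.Modules} {a b : ℕ}
    (hE : LocFree ((toPreMod X).obj E)) (hL : LocFree ((toPreMod X).obj L))
    {φ : tensorType E a b ⟶ L} (hφ : φ ≠ 0) (F : Fin a → Subobject E)
    [∀ i, IsIso (F i).arrow] (x : X) : NonvanishingOn φ F x := by
  have := hL.finite_stalk x
  by_contra h
  simp only [NonvanishingOn, not_exists, not_not] at h
  have hle : LinearMap.range (stalkMap φ x) ≤ IsLocalRing.maximalIdeal (X.presheaf.stalk x) •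
      LinearMap.range (stalkMap φ x) := by
    rintro _ ⟨t, rfl⟩
    obtain ⟨t, rfl⟩ := stalkMap_surjective_of_isIso (tensorSumMap (fun i => (F i).arrow) b) x t
    rw [← stalkMap_comp]
    exact h t
  have h0 := Submodule.eq_bot_of_le_smul_of_le_jacobson_bot _ _ (IsNoetherian.noetherian _) hle
    (IsLocalRing.maximalIdeal_le_jacobson _)
  obtain ⟨t, ht⟩ := exists_stalkMap_ne_zero hE hL hφ x
  exact ht ((Submodule.mem_bot _).1 (h0 ▸ LinearMap.mem_range_self (stalkMap φ x) t))

end Integral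

/-! ### The Segre product -/

/-- The canonical isomorphism `F₁ ⊗ ⋯ ⊗ F_{a+a'} ≅ (F₁ ⊗ ⋯ ⊗ F_a) ⊗ (F_{a+1} ⊗ ⋯ ⊗ F_{a+a'})`. -/
def preTensorAdd (a : ℕ) : (a' : ℕ) → (F : Fin (a + a') → PreMod X) →
    (preTensor (a + a') F ≅
      preTensor a (fun i => F (Fin.castAdd a' i)) ⊗ preTensor a' (fun i => F (Fin.natAdd a i)))
  | 0, F => (ρ_ (preTensor a F)).symm
  | a' + 1, F => whiskerRightIso (preTensorAdd a a' fun i => F i.castSucc) (F (Fin.last _)) ≪≫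
      α_ (preTensor a fun i => F (Fin.castAdd (a' + 1) i))
        (preTensor a' fun i => F (Fin.natAdd a i.castSucc)) (F (Fin.natAdd a (Fin.last a')))

/-- Naturality of the regrouping isomorphism, by induction on the number of factors in the second
block through naturality of the unitor and associator. The sources `F i` may differ, as required for
different steps of a filtration. -/
theorem preTensorMap_preTensorPowAdd (P : PreMod X) (a : ℕ) : ∀ (a' : ℕ)
    {F : Fin (a + a') → PreMod X} (f : ∀ i, F i ⟶ P),
    preTensorMap (a + a') f ≫ (preTensorPowAdd P a a').hom =
      (preTensorAdd a a' F).hom ≫ (preTensorMap a (fun i => f (Fin.castAdd a' i)) ⊗ₘ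
        preTensorMap a' (fun i => f (Fin.natAdd a i)))
  | 0, F, f => by
    refine (rightUnitor_inv_naturality (preTensorMap a f)).trans ?_
    exact congrArg (fun z => (ρ_ (preTensor a F)).inv ≫ z) (tensorHom_id _ _).symm
  | a' + 1, F, f => by
    have ih := preTensorMap_preTensorPowAdd P a a' fun i => f i.castSucc
    change (preTensorMap (a + a') (fun i => f i.castSucc) ⊗ₘ f (Fin.last _)) ≫
      ((preTensorPowAdd P a a').hom ▷ P ≫ (α_ (preTensorPow P a) (preTensorPow P a') P).hom) =
      ((preTensorAdd a a' fun i => F i.castSucc).hom ▷ (F (Fin.last _)) ≫ (α_ _ _ _).hom) ≫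
      (preTensorMap a (fun i => f (Fin.castAdd a' i).castSucc) ⊗ₘ
        (preTensorMap a' (fun i => f (Fin.natAdd a i).castSucc) ⊗ₘ f (Fin.last _)))
    rw [Category.assoc, ← associator_naturality, ← Category.assoc, ← Category.assoc]
    congr 1
    rw [← tensorHom_id, ← tensorHom_id, tensorHom_comp_tensorHom, tensorHom_comp_tensorHom, ih,
      Category.comp_id, Category.id_comp]

theorem component_segre {E M₁ M₂ : X.Modules} {a₁ b₁ a₂ b₂ : ℕ} (φ₁ : tensorType E a₁ b₁ ⟶ M₁)
    (φ₂ : tensorType E a₂ b₂ ⟶ M₂) (k : Fin (b₁ * b₂)) :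
    component (segre φ₁ φ₂) k = (preTensorPowAdd ((toPreMod X).obj E) a₁ a₂).hom ≫
      (component φ₁ (finProdFinEquiv.symm k).1 ⊗ₘ component φ₂ (finProdFinEquiv.symm k).2) ≫
        toAssoc _ := by
  rw [component, segre, biproduct.ι_desc, Adjunction.homEquiv_unit]
  refine ((assocSheafAdj X).unit.naturality _).symm.trans ?_
  exact Category.assoc _ _ _

theorem zero_tensorHom {P P' Q Q' : PreMod X} (v : Q ⟶ Q') : (0 : P ⟶ P') ⊗ₘ v = 0 := by
  refine hom_ext_sec fun U s => ?_
  obtain ⟨s, rfl⟩ := (tensorSec P Q U).surjective s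
  change appSec ((0 : P ⟶ P') ⊗ₘ v) U (tensorSec P Q U s) = 0
  induction s using TensorProduct.induction_on with
  | zero => simp
  | tmul s t => exact TensorProduct.zero_tmul (R := Γ(X, U)) _ _
  | add s t hs ht => rw [map_add, map_add, hs, ht, add_zero]

theorem tensorHom_zero {P P' Q Q' : PreMod X} (u : P ⟶ P') : u ⊗ₘ (0 : Q ⟶ Q') = 0 := by
  refine hom_ext_sec fun U s => ?_
  obtain ⟨s, rfl⟩ := (tensorSec P Q U).surjective s
  change appSec (u ⊗ₘ (0 : Q ⟶ Q')) U (tensorSec P Q U s) = 0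
  induction s using TensorProduct.induction_on with
  | zero => simp
  | tmul s t => exact TensorProduct.tmul_zero (R := Γ(X, U)) _ _
  | add s t hs ht => rw [map_add, map_add, hs, ht, add_zero]

section Integral

variable [IsIntegral X]

/-- Up to regrouping, component `(i, j)` of the restricted Segre product is the tensor product of
component `i` of the restricted `φ₁` and component `j` of the restricted `φ₂`. It is nonzero exactly
when both factors are, and `i` and `j` can be chosen independently. -/
theorem tensorSumMap_comp_segre_ne_zero_iff {E M₁ M₂ : X.Modules} {a₁ b₁ a₂ b₂ : ℕ}
    (hM₁ : LocFree ((toPreMod X).obj M₁)) (hM₂ : LocFree ((toPreMod X).obj M₂))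
    (φ₁ : tensorType E a₁ b₁ ⟶ M₁) (φ₂ : tensorType E a₂ b₂ ⟶ M₂)
    {F : Fin (a₁ + a₂) → X.Modules} (f : ∀ i, F i ⟶ E) :
    tensorSumMap f (b₁ * b₂) ≫ segre φ₁ φ₂ ≠ 0 ↔
      tensorSumMap (fun i => f (Fin.castAdd a₂ i)) b₁ ≫ φ₁ ≠ 0 ∧
        tensorSumMap (fun i => f (Fin.natAdd a₁ i)) b₂ ≫ φ₂ ≠ 0 := by
  have key : ∀ k, preTensorMap (a₁ + a₂) (fun i => (toPreMod X).map (f i)) ≫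
      component (segre φ₁ φ₂) k = (preTensorAdd a₁ a₂ _).hom ≫
        (((preTensorMap a₁ fun i => (toPreMod X).map (f (Fin.castAdd a₂ i))) ≫
          component φ₁ (finProdFinEquiv.symm k).1) ⊗ₘ
        ((preTensorMap a₂ fun i => (toPreMod X).map (f (Fin.natAdd a₁ i))) ≫
          component φ₂ (finProdFinEquiv.symm k).2)) ≫ toAssoc _ := by
    intro k
    rw [component_segre, ← Category.assoc, preTensorMap_preTensorPowAdd,
      ← tensorHom_comp_tensorHom]
    simp only [Category.assoc]
  simp only [ne_eq, tensorSumMap_comp_eq_zero_iff, key, not_forall]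
  constructor
  · rintro ⟨k, hk⟩
    refine ⟨⟨(finProdFinEquiv.symm k).1, fun h => hk ?_⟩,
      ⟨(finProdFinEquiv.symm k).2, fun h => hk ?_⟩⟩
    · rw [h, zero_tensorHom, zero_comp, comp_zero]
    · rw [h, tensorHom_zero, zero_comp, comp_zero]
  · rintro ⟨⟨i, hi⟩, ⟨j, hj⟩⟩
    refine ⟨finProdFinEquiv (i, j), fun h => ?_⟩
    rw [Equiv.symm_apply_apply] at h
    exact tensorHom_comp_toAssoc_ne_zero hM₁ hM₂ hi hj
      ((cancel_epi (preTensorAdd a₁ a₂ _).hom).1 (h.trans comp_zero.symm))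

theorem segre_ne_zero {E M₁ M₂ : X.Modules} {a₁ b₁ a₂ b₂ : ℕ}
    (hM₁ : LocFree ((toPreMod X).obj M₁)) (hM₂ : LocFree ((toPreMod X).obj M₂))
    {φ₁ : tensorType E a₁ b₁ ⟶ M₁} {φ₂ : tensorType E a₂ b₂ ⟶ M₂} (h₁ : φ₁ ≠ 0) (h₂ : φ₂ ≠ 0) :
    segre φ₁ φ₂ ≠ 0 := by
  intro h
  refine (tensorSumMap_comp_segre_ne_zero_iff hM₁ hM₂ φ₁ φ₂ fun _ => 𝟙 E).2
    ⟨tensorSumMap_comp_ne_zero _ h₁, tensorSumMap_comp_ne_zero _ h₂⟩ ?_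
  rw [h, comp_zero]

/-! ### The function `μ` -/

/-- The set of sums of weights whose minimum is `-μ(λ; σ(x))`. -/
def weightSums {E L : X.Modules} {a b : ℕ} (φ : tensorType E a b ⟶ L) (W : WeightedFiltration E)
    (x : X) : Set ℝ :=
  {t : ℝ | ∃ J : Fin a → Fin (W.length + 1),
    NonvanishingOn φ (fun i => W.step (J i)) x ∧ t = ((∑ i, W.gamma (J i) : ℚ) : ℝ)}

theorem bddBelow_weightSums {E L : X.Modules} {a b : ℕ} (φ : tensorType E a b ⟶ L)
    (W : WeightedFiltration E) (x : X) : BddBelow (weightSums φ W x) := by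
  refine ((Set.finite_range fun J : Fin a → Fin (W.length + 1) =>
    ((∑ i, W.gamma (J i) : ℚ) : ℝ)).subset ?_).bddBelow
  rintro t ⟨J, -, rfl⟩
  exact ⟨J, rfl⟩

theorem weightSums_subset {E L : X.Modules} {a b : ℕ} (hL : LocFree ((toPreMod X).obj L))
    (φ : tensorType E a b ⟶ L) (W : WeightedFiltration E) (x : X) :
    weightSums φ W x ⊆ weightSums φ W (genericPoint X) := by
  rintro t ⟨J, hJ, rfl⟩
  exact ⟨J, (nonvanishingOn_genericPoint_iff hL φ _).2 hJ.comp_ne_zero, rfl⟩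

/-- The constant multi-index at the last step, which is `E` itself, is always admissible. -/
theorem weightSums_nonempty [IsLocallyNoetherian X] {E L : X.Modules} {a b : ℕ}
    (hE : LocFree ((toPreMod X).obj E)) (hL : LocFree ((toPreMod X).obj L))
    {φ : tensorType E a b ⟶ L} (hφ : φ ≠ 0) (W : WeightedFiltration E) (x : X) :
    (weightSums φ W x).Nonempty := by
  have : IsIso (W.step (Fin.last _)).arrow := by
    rw [Subobject.isIso_arrow_iff_eq_top]
    exact Fin.snoc_last (α := fun _ => Subobject E) _ _
  exact ⟨_, fun _ => Fin.last _, nonvanishingOn_of_isIso hE hL hφ _ x, rfl⟩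

/-- The set of weight sums is largest at the generic point, so its infimum is smallest there.
Nonemptiness at every `x` matters: the real infimum of the empty set is `0` by convention and would
break the comparison. -/
theorem mu_eq_muAt_genericPoint [IsLocallyNoetherian X] {E L : X.Modules} {a b : ℕ}
    (hE : LocFree ((toPreMod X).obj E)) (hL : LocFree ((toPreMod X).obj L))
    {φ : tensorType E a b ⟶ L} (hφ : φ ≠ 0) (W : WeightedFiltration E) :
    mu φ W = muAt φ W (genericPoint X) := by
  have h : ∀ x, muAt φ W x ≤ muAt φ W (genericPoint X) := fun x =>
    neg_le_neg (csInf_le_csInf (bddBelow_weightSums φ W _) (weightSums_nonempty hE hL hφ W x)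
      (weightSums_subset hL φ W x))
  have : Nonempty X := ⟨genericPoint X⟩
  refine le_antisymm (ciSup_le h) (le_ciSup (f := fun x => muAt φ W x) ⟨muAt φ W (genericPoint X), ?_⟩ _)
  rintro _ ⟨x, rfl⟩
  exact h x

open Pointwise in
-- Splitting a multi-index into its first `a₁` and last `a₂` entries splits both the nonvanishing
-- condition and the sum of weights; `Fin.append` is the inverse operation.
theorem weightSums_segre {E M₁ M₂ : X.Modules} {a₁ b₁ a₂ b₂ : ℕ}
    (hM₁ : LocFree ((toPreMod X).obj M₁)) (hM₂ : LocFree ((toPreMod X).obj M₂))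
    (φ₁ : tensorType E a₁ b₁ ⟶ M₁) (φ₂ : tensorType E a₂ b₂ ⟶ M₂) (W : WeightedFiltration E) :
    weightSums (segre φ₁ φ₂) W (genericPoint X) =
      weightSums φ₁ W (genericPoint X) + weightSums φ₂ W (genericPoint X) := by
  have key : ∀ J : Fin (a₁ + a₂) → Fin (W.length + 1),
      NonvanishingOn (segre φ₁ φ₂) (fun i => W.step (J i)) (genericPoint X) ↔
        NonvanishingOn φ₁ (fun i => W.step (J (Fin.castAdd a₂ i))) (genericPoint X) ∧
          NonvanishingOn φ₂ (fun i => W.step (J (Fin.natAdd a₁ i))) (genericPoint X) := by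
    intro J
    rw [nonvanishingOn_genericPoint_iff (locFree_tensorSheaf hM₁ hM₂),
      nonvanishingOn_genericPoint_iff hM₁, nonvanishingOn_genericPoint_iff hM₂]
    exact tensorSumMap_comp_segre_ne_zero_iff hM₁ hM₂ φ₁ φ₂ fun i => (W.step (J i)).arrow
  ext t
  rw [Set.mem_add]
  constructor
  · rintro ⟨J, hJ, rfl⟩
    obtain ⟨h₁, h₂⟩ := (key J).1 hJ
    refine ⟨_, ⟨_, h₁, rfl⟩, _, ⟨_, h₂, rfl⟩, ?_⟩
    rw [Fin.sum_univ_add]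
    push_cast
    rfl
  · rintro ⟨_, ⟨J₁, h₁, rfl⟩, _, ⟨J₂, h₂, rfl⟩, rfl⟩
    refine ⟨Fin.append J₁ J₂, (key _).2 ?_, ?_⟩
    · simp only [Fin.append_left, Fin.append_right]
      exact ⟨h₁, h₂⟩
    · rw [Fin.sum_univ_add]
      simp only [Fin.append_left, Fin.append_right]
      push_cast
      rfl

theorem mu_segre [IsLocallyNoetherian X] {E M₁ M₂ : X.Modules} {a₁ b₁ a₂ b₂ : ℕ}
    (hE : LocFree ((toPreMod X).obj E)) (hM₁ : LocFree ((toPreMod X).obj M₁))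
    (hM₂ : LocFree ((toPreMod X).obj M₂)) {φ₁ : tensorType E a₁ b₁ ⟶ M₁}
    {φ₂ : tensorType E a₂ b₂ ⟶ M₂} (h₁ : φ₁ ≠ 0) (h₂ : φ₂ ≠ 0) (W : WeightedFiltration E) :
    mu (segre φ₁ φ₂) W = mu φ₁ W + mu φ₂ W := by
  rw [mu_eq_muAt_genericPoint hE (locFree_tensorSheaf hM₁ hM₂) (segre_ne_zero hM₁ hM₂ h₁ h₂),
    mu_eq_muAt_genericPoint hE hM₁ h₁, mu_eq_muAt_genericPoint hE hM₂ h₂]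
  change -sInf (weightSums _ _ _) = -sInf (weightSums _ _ _) + -sInf (weightSums _ _ _)
  rw [weightSums_segre hM₁ hM₂, csInf_add (weightSums_nonempty hE hM₁ h₁ W _)
    (bddBelow_weightSums _ _ _) (weightSums_nonempty hE hM₂ h₂ W _) (bddBelow_weightSums _ _ _),
    neg_add]

end Integral

end DecBundle

end

/-! ### Stability of double-decorated bundles -/

theorem mainTheorem8 (C : Curve) (x₁ x₂ : C.X) (hx₁ : IsClosed {x₁}) (hx₂ : IsClosed {x₂})
    (hx : x₁ ≠ x₂) (d : ℤ) (r a₁ b₁ c₁ a₂ b₂ c₂ : ℕ) (L₁ L₂ : C.X.Modules)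
    (hL₁ : IsVectorBundle L₁ 1) (hL₂ : IsVectorBundle L₂ 1)
    (T : TwoDGPB C x₁ x₂ d r a₁ b₁ c₁ a₂ b₂ c₂ L₁ L₂) (hφ₁ : T.φ₁ ≠ 0) (hφ₂ : T.φ₂ ≠ 0) :
    T.toDGPB.φ ≠ 0 ∧
    (∀ W : WeightedFiltration T.E, mu T.toDGPB.φ W = mu T.φ₁ W + mu T.φ₂ W) ∧
    ∀ δ : ℚ, 0 < δ →
      (T.IsSemistable δ δ ↔ T.toDGPB.IsSemistable δ) ∧
      (T.IsStable δ δ ↔ T.toDGPB.IsStable δ) := by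
  have hE := T.isVectorBundle.locFree
  have hM₁ := locFree_twist_detBundle hE hL₁.locFree r c₁
  have hM₂ := locFree_twist_detBundle hE hL₂.locFree r c₂
  have hmu : ∀ W : WeightedFiltration T.E, mu T.toDGPB.φ W = mu T.φ₁ W + mu T.φ₂ W :=
    mu_segre hE hM₁ hM₂ hφ₁ hφ₂
  have hsum : ∀ (δ : ℚ) (W : WeightedFiltration T.E),
      (T.P W : ℝ) + δ * mu T.φ₁ W + δ * mu T.φ₂ W =
        (T.toDGPB.P W : ℝ) + δ * mu T.toDGPB.φ W := by
    intro δ W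
    rw [hmu, mul_add, ← add_assoc]
    -- Passing to `T.toDGPB` keeps the pair `(E, q)`, so the two values of `P` agree by definition.
    rfl
  refine ⟨segre_ne_zero hM₁ hM₂ hφ₁ hφ₂, hmu, fun δ _ => ⟨?_, ?_⟩⟩
  · exact forall_congr' fun W => by rw [hsum]
  · exact forall_congr' fun W => by rw [hsum]
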